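/- Let $H$ be a (real or complex) Hilbert space, $I$ a countable index set and $\Psi=\{\psi_i\}_{i\in I}$ a sequence in $H$. The analysis operator of $\Psi$ is $$C_\Psi f=\{\langle f,\psi_i\rangle\}_{i\in I}\in\ell^2(I),\qquad \operatorname{dom}(C_\Psi)=\Big\{f\in H:\ \sum_{i\in I}|\langle f,\psi_i\rangle|^2<\infty\Big\}.$$ $\Psi$ is a *lower frame sequence* for $H$ if there is a constant $A>0$ such that $\sqrt{A}\,\|f\|\le\|C_\Psi f\|$ for all $f\in\operatorname{dom}(C_\Psi)$; it is *complete* if $\sum_{i\in I}|\langle f,\psi_i\rangle|^2>0$ for every non-zero $f\in H$, and *incomplete* otherwise. Put $H_\Psi=\overline{\operatorname{dom}(C_\Psi)}$, let $\pi$ be the orthogonal projection of $H$ onto $H_\Psi$, let $C^r_\Psi$ be the analysis operator of the sequence $\{\pi\psi_i\}_{i\in I}$ in the Hilbert space $H_\Psi$ (it is densely defined), and let $\Gamma_\Psi=(C^r_\Psi)^*C^r_\Psi$, an operator in $H_\Psi$ with its natural domain. If $\Psi$ is a lower frame sequence, then $\Gamma_\Psi$ is a bijection from its domain onto $H_\Psi$,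 and the *canonical dual* $\widetilde\Psi=\{\widetilde\psi_i\}_{i\in I}$ of $\Psi$ is defined by $\widetilde\psi_i=\Gamma_\Psi^{-1}\pi\psi_i$. **Theorem.** Let $\Psi$ be a lower frame sequence for $H$ and let $j\in I$. 1. If $\langle\psi_j,\widetilde\psi_j\rangle\neq 1$, then $\{\psi_k\}_{k\in I,\,k\neq j}$ is a lower frame sequence for $H$. 2. If $\langle\psi_j,\widetilde\psi_j\rangle=1$, then $\{\psi_k\}_{k\in I,\,k\neq j}$ is incomplete in $H$. -/

import Mathlib

open scoped InnerProductSpace ENNReal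

noncomputable section

namespace FrameSeq

/-- The composition `g ∘ f` of two partially defined linear operators, on its natural domain
`{x ∈ dom f | f x ∈ dom g}`. -/
def pcomp {𝕜 E F G : Type*} [Ring 𝕜] [AddCommGroup E] [Module 𝕜 E] [AddCommGroup F] [Module 𝕜 F]
    [AddCommGroup G] [Module 𝕜 G] (g : F →ₗ.[𝕜] G) (f : E →ₗ.[𝕜] F) : E →ₗ.[𝕜] G where
  domain :=
    { carrier := {x | ∃ hx : x ∈ f.domain, f ⟨x, hx⟩ ∈ g.domain}
      zero_mem' := ⟨f.domain.zero_mem, by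
        have : f ⟨0, f.domain.zero_mem⟩ = 0 := f.map_zero
        rw [this]; exact g.domain.zero_mem⟩
      add_mem' := by
        rintro x y ⟨hx, hfx⟩ ⟨hy, hfy⟩
        refine ⟨f.domain.add_mem hx hy, ?_⟩
        have : f ⟨x + y, f.domain.add_mem hx hy⟩ = f ⟨x, hx⟩ + f ⟨y, hy⟩ :=
          f.map_add ⟨x, hx⟩ ⟨y, hy⟩
        rw [this]; exact g.domain.add_mem hfx hfy
      smul_mem' := by
        rintro c x ⟨hx, hfx⟩
        refine ⟨f.domain.smul_mem c hx, ?_⟩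
        have : f ⟨c • x, f.domain.smul_mem c hx⟩ = c • f ⟨x, hx⟩ := f.map_smul c ⟨x, hx⟩
        rw [this]; exact g.domain.smul_mem c hfx }
  toFun :=
    { toFun := fun x => g ⟨f ⟨x, x.2.fst⟩, x.2.snd⟩
      map_add' := by
        intro x y
        rw [← g.map_add]
        congr 1
        exact Subtype.ext (f.map_add ⟨x, x.2.fst⟩ ⟨y, y.2.fst⟩)
      map_smul' := by
        intro c x
        rw [RingHom.id_apply, ← g.map_smul]
        congr 1
        exact Subtype.ext (f.map_smul c ⟨x, x.2.fst⟩) }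

theorem pcomp_domain_le {𝕜 E F G : Type*} [Ring 𝕜] [AddCommGroup E] [Module 𝕜 E] [AddCommGroup F]
    [Module 𝕜 F] [AddCommGroup G] [Module 𝕜 G] (g : F →ₗ.[𝕜] G) (f : E →ₗ.[𝕜] F) :
    (pcomp g f).domain ≤ f.domain :=
  fun _ hx => hx.fst

theorem inner_pcomp_adjoint {𝕜 E F : Type*} [RCLike 𝕜] [NormedAddCommGroup E]
    [InnerProductSpace 𝕜 E] [CompleteSpace E] [NormedAddCommGroup F] [InnerProductSpace 𝕜 F]
    {T : E →ₗ.[𝕜] F} (hT : Dense (T.domain : Set E))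
    (f : (pcomp (LinearPMap.adjoint T) T).domain) (g : T.domain) :
    ⟪pcomp (LinearPMap.adjoint T) T f, (g : E)⟫_𝕜 = ⟪T ⟨f, pcomp_domain_le _ _ f.2⟩, T g⟫_𝕜 :=
  LinearPMap.adjoint_isFormalAdjoint hT ⟨T ⟨f, f.2.fst⟩, f.2.snd⟩ g

theorem exists_pcomp_adjoint_eq {𝕜 E F : Type*} [RCLike 𝕜] [NormedAddCommGroup E]
    [InnerProductSpace 𝕜 E] [CompleteSpace E] [NormedAddCommGroup F] [InnerProductSpace 𝕜 F]
    {T : E →ₗ.[𝕜] F} (hT : Dense (T.domain : Set E)) (x : E) (f : T.domain)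
    (hf : ∀ g : T.domain, ⟪T f, T g⟫_𝕜 = ⟪x, (g : E)⟫_𝕜) :
    ∃ y, pcomp (LinearPMap.adjoint T) T y = x := by
  have hm : T f ∈ (LinearPMap.adjoint T).domain :=
    LinearPMap.mem_adjoint_domain_of_exists _ ⟨x, fun g => (hf g).symm⟩
  exact ⟨⟨f, f.2, hm⟩, LinearPMap.adjoint_apply_eq hT ⟨_, hm⟩ fun g => (hf g).symm⟩

section Basic

variable {𝕜 : Type*} [RCLike 𝕜] {H : Type*} [NormedAddCommGroup H] [InnerProductSpace 𝕜 H]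
  {I : Type*}

/-- The analysis operator `f ↦ (⟨f, ψ i⟩)_i`, from `H` to `ℓ²(I)`, with domain all `f` whose
coefficient family is square summable. Mathlib's inner product is linear in its second argument,
so the coefficient that is linear in `f` is `⟪ψ i, f⟫`. -/
def analysisOp (ψ : I → H) : H →ₗ.[𝕜] lp (fun _ : I => 𝕜) 2 where
  domain :=
    { carrier := {f | Memℓp (fun i => ⟪ψ i, f⟫_𝕜) 2}
      zero_mem' := by
        have : (fun i => ⟪ψ i, (0 : H)⟫_𝕜) = 0 := by ext i; simp
        simp only [Set.mem_ofPred_eq, this]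
        exact zero_memℓp
      add_mem' := by
        intro f g hf hg
        have : (fun i => ⟪ψ i, f + g⟫_𝕜) = (fun i => ⟪ψ i, f⟫_𝕜) + fun i => ⟪ψ i, g⟫_𝕜 := by
          ext i; simp [inner_add_right]
        simp only [Set.mem_ofPred_eq, this]
        exact hf.add hg
      smul_mem' := by
        intro c f hf
        have : (fun i => ⟪ψ i, c • f⟫_𝕜) = c • fun i => ⟪ψ i, f⟫_𝕜 := by
          ext i; simp [inner_smul_right]
        simp only [Set.mem_ofPred_eq, this]
        exact hf.const_smul c }
  toFun :=
    { toFun := fun f => ⟨fun i => ⟪ψ i, (f : H)⟫_𝕜, f.2⟩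
      map_add' := by intro f g; ext i; exact inner_add_right _ _ _
      map_smul' := by intro c f; ext i; exact inner_smul_right _ _ _ }

/-- `ψ` is a lower frame sequence for `H`: there is `A > 0` with `√A ‖f‖ ≤ ‖C f‖` for all `f` in
the domain of the analysis operator `C`. -/
def IsLowerFrameSeq (𝕜 : Type*) [RCLike 𝕜] {H : Type*} [NormedAddCommGroup H]
    [InnerProductSpace 𝕜 H] {I : Type*} (ψ : I → H) : Prop :=
  ∃ A : ℝ, 0 < A ∧ ∀ f : (analysisOp (𝕜 := 𝕜) ψ).domain,
    Real.sqrt A * ‖(f : H)‖ ≤ ‖analysisOp (𝕜 := 𝕜) ψ f‖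

/-- `ψ` is complete in `H`: `∑ i, |⟨f, ψ i⟩|² > 0` for every non-zero `f`; the sum is taken in
`[0, ∞]`. -/
def IsCompleteSeq (𝕜 : Type*) [RCLike 𝕜] {H : Type*} [NormedAddCommGroup H]
    [InnerProductSpace 𝕜 H] {I : Type*} (ψ : I → H) : Prop :=
  ∀ f : H, f ≠ 0 → 0 < ∑' i, ENNReal.ofReal (‖⟪ψ i, f⟫_𝕜‖ ^ 2)

/-- The closure in `H` of the domain of the analysis operator. -/
abbrev domSpace (𝕜 : Type*) [RCLike 𝕜] {H : Type*} [NormedAddCommGroup H]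
    [InnerProductSpace 𝕜 H] {I : Type*} (ψ : I → H) : Submodule 𝕜 H :=
  (analysisOp (𝕜 := 𝕜) ψ).domain.topologicalClosure

theorem ker_analysisOp {ψ : I → H} (h : IsLowerFrameSeq 𝕜 ψ) :
    (analysisOp (𝕜 := 𝕜) ψ).toFun.ker = ⊥ := by
  obtain ⟨A, hA, hb⟩ := h
  have hs : 0 < Real.sqrt A := Real.sqrt_pos.2 hA
  rw [LinearMap.ker_eq_bot']
  intro f hf
  have h1 := hb f
  have h2 : analysisOp (𝕜 := 𝕜) ψ f = 0 := hf
  rw [h2, norm_zero] at h1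
  have : ‖(f : H)‖ = 0 := le_antisymm (by nlinarith [norm_nonneg (f : H)]) (norm_nonneg _)
  exact Subtype.ext (norm_eq_zero.1 this)

variable [CompleteSpace H]

/-- The orthogonal projections of the `ψ i` onto `domSpace 𝕜 ψ`, as a sequence in that Hilbert
space. -/
def projSeq (𝕜 : Type*) [RCLike 𝕜] {H : Type*} [NormedAddCommGroup H]
    [InnerProductSpace 𝕜 H] [CompleteSpace H] {I : Type*} (ψ : I → H) : I → domSpace 𝕜 ψ :=
  fun i => (domSpace 𝕜 ψ).orthogonalProjectionOnto (ψ i)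

/-- The restricted analysis operator: the analysis operator of the projected sequence in the
Hilbert space `domSpace 𝕜 ψ`. -/
def restrictedAnalysisOp (ψ : I → H) : domSpace 𝕜 ψ →ₗ.[𝕜] lp (fun _ : I => 𝕜) 2 :=
  analysisOp (projSeq 𝕜 ψ)

/-- The generalized frame operator `Γ = C* C` in `domSpace 𝕜 ψ`, where `C` is the restricted
analysis operator (densely defined by `dense_restrictedAnalysisOp_domain`) and `C*` is its
Hilbert-space adjoint. -/
def genFrameOp (ψ : I → H) : domSpace 𝕜 ψ →ₗ.[𝕜] domSpace 𝕜 ψ :=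
  pcomp (LinearPMap.adjoint (restrictedAnalysisOp (𝕜 := 𝕜) ψ)) (restrictedAnalysisOp (𝕜 := 𝕜) ψ)

/-! Facts that make `Γ⁻¹` well defined. -/

theorem inner_projSeq (ψ : I → H) (i : I) (f : domSpace 𝕜 ψ) :
    ⟪projSeq 𝕜 ψ i, f⟫_𝕜 = ⟪ψ i, (f : H)⟫_𝕜 := by
  exact Submodule.inner_orthogonalProjectionOnto_eq_of_mem_right f (ψ i)

theorem mem_restrictedAnalysisOp_domain (ψ : I → H) (f : domSpace 𝕜 ψ) :
    f ∈ (restrictedAnalysisOp (𝕜 := 𝕜) ψ).domain ↔ (f : H) ∈ (analysisOp (𝕜 := 𝕜) ψ).domain := by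
  change Memℓp (fun i => ⟪projSeq 𝕜 ψ i, f⟫_𝕜) 2 ↔ Memℓp (fun i => ⟪ψ i, (f : H)⟫_𝕜) 2
  simp only [inner_projSeq]

theorem dense_restrictedAnalysisOp_domain (ψ : I → H) :
    Dense ((restrictedAnalysisOp (𝕜 := 𝕜) ψ).domain : Set (domSpace 𝕜 ψ)) := by
  intro x
  rw [closure_subtype]
  have hx : (x : H) ∈ closure ((analysisOp (𝕜 := 𝕜) ψ).domain : Set H) := x.2
  refine closure_mono ?_ hx
  intro y hy
  exact ⟨⟨y, subset_closure hy⟩, (mem_restrictedAnalysisOp_domain ψ _).2 hy, rfl⟩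

theorem norm_restrictedAnalysisOp (ψ : I → H) (f : (restrictedAnalysisOp (𝕜 := 𝕜) ψ).domain) :
    ‖restrictedAnalysisOp (𝕜 := 𝕜) ψ f‖ = ‖analysisOp (𝕜 := 𝕜) ψ
      ⟨(f : domSpace 𝕜 ψ), (mem_restrictedAnalysisOp_domain ψ _).1 f.2⟩‖ := by
  congr 1
  ext i
  exact inner_projSeq ψ i f.1

theorem isClosed_range_analysisOp {ψ : I → H} (h : IsLowerFrameSeq 𝕜 ψ) :
    IsClosed (LinearMap.range (analysisOp (𝕜 := 𝕜) ψ).toFun : Set (lp (fun _ : I => 𝕜) 2)) := by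
  obtain ⟨A, hA, hb⟩ := h
  have hs : 0 < Real.sqrt A := Real.sqrt_pos.2 hA
  refine IsSeqClosed.isClosed ?_
  intro y p hy hp
  choose f hf using hy
  have hc : CauchySeq (fun n => (f n : H)) := by
    rw [Metric.cauchySeq_iff]
    intro ε hε
    obtain ⟨N, hN⟩ := Metric.cauchySeq_iff.1 hp.cauchySeq (Real.sqrt A * ε) (by positivity)
    refine ⟨N, fun m hm n hn => ?_⟩
    have h1 := hN m hm n hn
    have h2 := hb (f m - f n)
    rw [dist_eq_norm] at h1 ⊢
    have h3 : analysisOp (𝕜 := 𝕜) ψ (f m - f n) = y m - y n := by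
      rw [LinearPMap.map_sub, ← hf, ← hf]; rfl
    rw [h3] at h2
    exact lt_of_mul_lt_mul_left (h2.trans_lt h1) hs.le
  obtain ⟨x, hx⟩ := cauchySeq_tendsto_of_complete hc
  have key : (fun i => ⟪ψ i, x⟫_𝕜) = (p : I → 𝕜) := by
    ext i
    have t1 : Filter.Tendsto (fun n => ⟪ψ i, (f n : H)⟫_𝕜) Filter.atTop (nhds ⟪ψ i, x⟫_𝕜) :=
      Filter.Tendsto.inner tendsto_const_nhds hx
    have t2 : Filter.Tendsto (fun n => (y n : I → 𝕜) i) Filter.atTop (nhds ((p : I → 𝕜) i)) := by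
      rw [tendsto_iff_norm_sub_tendsto_zero] at hp ⊢
      refine squeeze_zero (fun _ => norm_nonneg _) (fun n => ?_) hp
      exact lp.norm_apply_le_norm (by norm_num) (y n - p) i
    refine tendsto_nhds_unique t1 (t2.congr fun n => ?_)
    rw [← hf]; rfl
  have hmem : x ∈ (analysisOp (𝕜 := 𝕜) ψ).domain := by
    change Memℓp (fun i => ⟪ψ i, x⟫_𝕜) 2
    rw [key]; exact p.2
  exact ⟨⟨x, hmem⟩, by ext i; exact congrFun key i⟩

/-- Riesz representation with respect to the form `(f, g) ↦ ⟨C f, C g⟩`. -/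
theorem exists_analysisOp_inner_eq {ψ : I → H} (h : IsLowerFrameSeq 𝕜 ψ) (x : H) :
    ∃ f : (analysisOp (𝕜 := 𝕜) ψ).domain, ∀ g : (analysisOp (𝕜 := 𝕜) ψ).domain,
      ⟪analysisOp (𝕜 := 𝕜) ψ f, analysisOp (𝕜 := 𝕜) ψ g⟫_𝕜 = ⟪x, (g : H)⟫_𝕜 := by
  have hcl := isClosed_range_analysisOp h
  let R := LinearMap.range (analysisOp (𝕜 := 𝕜) ψ).toFun
  have : CompleteSpace R := hcl.completeSpace_coe
  let e := LinearEquiv.ofInjective _ (LinearMap.ker_eq_bot.1 (ker_analysisOp h))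
  obtain ⟨A, hA, hb⟩ := h
  have hs : 0 < Real.sqrt A := Real.sqrt_pos.2 hA
  let φ : R →ₗ[𝕜] 𝕜 :=
    (innerₛₗ 𝕜 x).comp ((analysisOp (𝕜 := 𝕜) ψ).domain.subtype.comp e.symm.toLinearMap)
  let Φ : R →L[𝕜] 𝕜 := φ.mkContinuous (‖x‖ / Real.sqrt A) (by
    intro r
    obtain ⟨f, rfl⟩ := e.surjective r
    have h1 : φ (e f) = ⟪x, (f : H)⟫_𝕜 := by simp [φ]
    have h2 : ‖e f‖ = ‖analysisOp (𝕜 := 𝕜) ψ f‖ := rfl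
    rw [h1, h2, div_mul_eq_mul_div, le_div_iff₀ hs]
    calc ‖⟪x, (f : H)⟫_𝕜‖ * Real.sqrt A ≤ ‖x‖ * ‖(f : H)‖ * Real.sqrt A := by
          gcongr; exact norm_inner_le_norm _ _
      _ = ‖x‖ * (Real.sqrt A * ‖(f : H)‖) := by ring
      _ ≤ _ := by gcongr; exact hb f)
  obtain ⟨f, hf⟩ := e.surjective ((InnerProductSpace.toDual 𝕜 R).symm Φ)
  refine ⟨f, fun g => ?_⟩
  have h1 : ⟪(InnerProductSpace.toDual 𝕜 R).symm Φ, e g⟫_𝕜 = Φ (e g) :=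
    InnerProductSpace.toDual_symm_apply
  rw [← hf] at h1
  have h2 : Φ (e g) = ⟪x, (g : H)⟫_𝕜 := by simp [Φ, φ]
  rw [← h2, ← h1]; rfl

theorem isLowerFrameSeq_projSeq {ψ : I → H} (h : IsLowerFrameSeq 𝕜 ψ) :
    IsLowerFrameSeq 𝕜 (projSeq 𝕜 ψ) := by
  obtain ⟨A, hA, hb⟩ := h
  refine ⟨A, hA, fun f => ?_⟩
  exact (hb _).trans_eq (norm_restrictedAnalysisOp ψ f).symm

theorem genFrameOp_domain_le (ψ : I → H) :
    (genFrameOp (𝕜 := 𝕜) ψ).domain ≤ (restrictedAnalysisOp (𝕜 := 𝕜) ψ).domain :=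
  pcomp_domain_le _ _

/-- `⟨Γ f, g⟩ = ⟨C f, C g⟩`. -/
theorem inner_genFrameOp (ψ : I → H) (f : (genFrameOp (𝕜 := 𝕜) ψ).domain)
    (g : (restrictedAnalysisOp (𝕜 := 𝕜) ψ).domain) :
    ⟪genFrameOp (𝕜 := 𝕜) ψ f, (g : domSpace 𝕜 ψ)⟫_𝕜
      = ⟪restrictedAnalysisOp (𝕜 := 𝕜) ψ ⟨f, genFrameOp_domain_le ψ f.2⟩,
          restrictedAnalysisOp (𝕜 := 𝕜) ψ g⟫_𝕜 :=
  inner_pcomp_adjoint (T := restrictedAnalysisOp (𝕜 := 𝕜) ψ)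
    (dense_restrictedAnalysisOp_domain (𝕜 := 𝕜) ψ) f g

/-- For a lower frame sequence `Γ` is injective. -/
theorem ker_genFrameOp {ψ : I → H} (h : IsLowerFrameSeq 𝕜 ψ) :
    (genFrameOp (𝕜 := 𝕜) ψ).toFun.ker = ⊥ := by
  rw [LinearMap.ker_eq_bot']
  intro f hf
  have h0 : genFrameOp (𝕜 := 𝕜) ψ f = 0 := hf
  have h1 := inner_genFrameOp ψ f ⟨f, genFrameOp_domain_le ψ f.2⟩
  rw [h0, inner_zero_left] at h1
  have h2 := inner_self_eq_zero.1 h1.symm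
  have h3 := LinearMap.ker_eq_bot'.1 (ker_analysisOp (isLowerFrameSeq_projSeq h)) _ h2
  have h4 : (f : domSpace 𝕜 ψ) = 0 := congrArg Subtype.val h3
  exact Subtype.ext h4

/-- For a lower frame sequence `Γ` is onto `domSpace 𝕜 ψ`. -/
theorem range_genFrameOp {ψ : I → H} (h : IsLowerFrameSeq 𝕜 ψ) :
    LinearMap.range (genFrameOp (𝕜 := 𝕜) ψ).toFun = ⊤ := by
  rw [LinearMap.range_eq_top]
  intro x
  obtain ⟨f, hf⟩ := exists_analysisOp_inner_eq (isLowerFrameSeq_projSeq h) x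
  exact exists_pcomp_adjoint_eq (T := restrictedAnalysisOp (𝕜 := 𝕜) ψ)
    (dense_restrictedAnalysisOp_domain (𝕜 := 𝕜) ψ) x f hf

/-- For a lower frame sequence `Γ⁻¹` is defined on all of `domSpace 𝕜 ψ`. -/
theorem mem_inverse_genFrameOp_domain {ψ : I → H} (h : IsLowerFrameSeq 𝕜 ψ) (x : domSpace 𝕜 ψ) :
    x ∈ (genFrameOp (𝕜 := 𝕜) ψ).inverse.domain := by
  rw [LinearPMap.inverse_domain, range_genFrameOp h]; trivial

/-- The canonical dual `i ↦ Γ⁻¹ π (ψ i)` of a lower frame sequence `ψ`, where `π` is the orthogonal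
projection onto `domSpace 𝕜 ψ`. -/
def canonicalDual {ψ : I → H} (h : IsLowerFrameSeq 𝕜 ψ) (i : I) : H :=
  ((genFrameOp (𝕜 := 𝕜) ψ).inverse
    ⟨projSeq 𝕜 ψ i, mem_inverse_genFrameOp_domain h (projSeq 𝕜 ψ i)⟩ : domSpace 𝕜 ψ)

end Basic

end FrameSeq

end

namespace FrameSeq

/-! Write `C` for the analysis operator of `ψ`, `C'` for that of the family without `ψ j`, and `u`
for the `j`-th canonical dual vector. Since `Γ u = π (ψ j)`, the vector `u` represents `⟪ψ j, ·⟫`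
for the form `⟪C f, C g⟫` on `dom C` (`inner_analysisOp_canonicalDual`). Testing against `u` itself
gives `⟪ψ j, u⟫ = t` with `t = ‖C u‖²`, a nonnegative real. The `j`-th summand of `‖C u‖²` is `t²`,
so `t² ≤ t` and `t ≤ 1`.

Deleting `ψ j` keeps the domain and gives `‖C f‖² = |⟪ψ j, f⟫|² + ‖C' f‖²`
(`norm_sq_analysisOp_eq_add`). If `t < 1`, Cauchy–Schwarz bounds the deleted term by `t ‖C f‖²`, so
a positive fraction of the lower bound survives. If `t = 1`, then `‖C' u‖² = t - t² = 0` while `u ≠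
0`, so `u` witnesses incompleteness. -/

theorem hasSum_ne_iff {I : Type*} {f : I → ℝ} {a : ℝ} (j : I) :
    HasSum (fun k : {k : I // k ≠ j} => f k) a ↔ HasSum f (f j + a) := by
  have h : HasSum (f ∘ (↑) : ({j} : Set I) → ℝ) (f j) :=
    hasSum_unique (f ∘ (↑) : ({j} : Set I) → ℝ)
  exact h.hasSum_compl_iff

/-! ### Deleting one element from the sequence. -/

section Analysis

variable {𝕜 : Type*} [RCLike 𝕜] {H : Type*} [NormedAddCommGroup H] [InnerProductSpace 𝕜 H]
  {I : Type*}

theorem mem_analysisOp_domain_iff (ψ : I → H) (f : H) :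
    f ∈ (analysisOp (𝕜 := 𝕜) ψ).domain ↔ Summable fun i => ‖⟪ψ i, f⟫_𝕜‖ ^ 2 := by
  change Memℓp (fun i => ⟪ψ i, f⟫_𝕜) 2 ↔ _
  rw [memℓp_gen_iff (by norm_num)]
  simp

theorem hasSum_norm_sq_analysisOp (ψ : I → H) (f : (analysisOp (𝕜 := 𝕜) ψ).domain) :
    HasSum (fun i => ‖⟪ψ i, (f : H)⟫_𝕜‖ ^ 2) (‖analysisOp (𝕜 := 𝕜) ψ f‖ ^ 2) := by
  have h := lp.hasSum_norm (p := 2) (by norm_num) (analysisOp (𝕜 := 𝕜) ψ f)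
  simp only [ENNReal.toReal_ofNat, Real.rpow_ofNat] at h
  exact h

/-- A single term does not affect summability. Lower bounds for the full and the reduced sequence
therefore concern the same vectors `f`. -/
theorem mem_analysisOp_domain_ne_iff (ψ : I → H) (j : I) (f : H) :
    f ∈ (analysisOp (𝕜 := 𝕜) (fun k : {k : I // k ≠ j} => ψ k)).domain ↔
      f ∈ (analysisOp (𝕜 := 𝕜) ψ).domain := by
  rw [mem_analysisOp_domain_iff, mem_analysisOp_domain_iff]
  constructor
  · rintro ⟨a, ha⟩
    exact ⟨_, (hasSum_ne_iff (f := fun i => ‖⟪ψ i, f⟫_𝕜‖ ^ 2) j).1 ha⟩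
  · intro h
    exact h.comp_injective Subtype.val_injective

/-- Removing `ψ j` from the sequence removes one summand from `‖C f‖²`. -/
theorem norm_sq_analysisOp_eq_add (ψ : I → H) (j : I)
    (f : (analysisOp (𝕜 := 𝕜) (fun k : {k : I // k ≠ j} => ψ k)).domain) :
    ‖analysisOp (𝕜 := 𝕜) ψ ⟨f, (mem_analysisOp_domain_ne_iff ψ j f).1 f.2⟩‖ ^ 2 =
      ‖⟪ψ j, (f : H)⟫_𝕜‖ ^ 2 +
        ‖analysisOp (𝕜 := 𝕜) (fun k : {k : I // k ≠ j} => ψ k) f‖ ^ 2 :=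
  (hasSum_norm_sq_analysisOp ψ ⟨f, (mem_analysisOp_domain_ne_iff ψ j f).1 f.2⟩).unique
    ((hasSum_ne_iff (f := fun i => ‖⟪ψ i, (f : H)⟫_𝕜‖ ^ 2) j).1
      (hasSum_norm_sq_analysisOp (fun k : {k : I // k ≠ j} => ψ k) f))

/-- If a vector `u` represents `⟪ψ j, ·⟫` with respect to the form `(f, g) ↦ ⟪C f, C g⟫` and
`‖C u‖ < 1`, then `ψ j` can be removed from a lower frame sequence. -/
theorem isLowerFrameSeq_ne_of_norm_lt_one {ψ : I → H} (hψ : IsLowerFrameSeq 𝕜 ψ) (j : I)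
    (u : (analysisOp (𝕜 := 𝕜) ψ).domain)
    (hu : ∀ g : (analysisOp (𝕜 := 𝕜) ψ).domain,
      ⟪analysisOp (𝕜 := 𝕜) ψ u, analysisOp (𝕜 := 𝕜) ψ g⟫_𝕜 = ⟪ψ j, (g : H)⟫_𝕜)
    (h1 : ‖analysisOp (𝕜 := 𝕜) ψ u‖ < 1) :
    IsLowerFrameSeq 𝕜 (fun k : {k : I // k ≠ j} => ψ k) := by
  obtain ⟨A, hA, hb⟩ := hψ
  set c := ‖analysisOp (𝕜 := 𝕜) ψ u‖ with hc
  have hc0 : 0 ≤ c := norm_nonneg _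
  have hpos : 0 < 1 - c ^ 2 := by nlinarith
  -- By Cauchy–Schwarz the deleted term is at most `c ^ 2 * ‖C f‖ ^ 2`, so the fraction `1 - c ^ 2`
  -- of `‖C f‖ ^ 2` remains.
  refine ⟨(1 - c ^ 2) * A, mul_pos hpos hA, fun f => ?_⟩
  have hsum := norm_sq_analysisOp_eq_add ψ j f
  set g : (analysisOp (𝕜 := 𝕜) ψ).domain := ⟨f, (mem_analysisOp_domain_ne_iff ψ j f).1 f.2⟩
  have hCS : ‖⟪ψ j, (f : H)⟫_𝕜‖ ≤ c * ‖analysisOp (𝕜 := 𝕜) ψ g‖ := by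
    have h := norm_inner_le_norm (𝕜 := 𝕜) (analysisOp (𝕜 := 𝕜) ψ u) (analysisOp (𝕜 := 𝕜) ψ g)
    rwa [hu g] at h
  have hCS2 := pow_le_pow_left₀ (norm_nonneg _) hCS 2
  have hlow := pow_le_pow_left₀ (by positivity) (hb g) 2
  rw [mul_pow, Real.sq_sqrt hA.le] at hlow
  refine le_of_sq_le_sq ?_ (norm_nonneg _)
  rw [mul_pow, Real.sq_sqrt (by positivity)]
  have h2 := mul_le_mul_of_nonneg_left hlow hpos.le
  have h3 : ‖(g : H)‖ = ‖(f : H)‖ := rfl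
  rw [h3] at h2
  linarith

/-- If a vector `u` represents `⟪ψ j, ·⟫` with respect to the form `(f, g) ↦ ⟪C f, C g⟫` and
`⟪ψ j, u⟫ = 1`, then `u` is orthogonal to all `ψ k` with `k ≠ j`. -/
theorem not_isCompleteSeq_ne_of_inner_eq_one {ψ : I → H} (j : I)
    (u : (analysisOp (𝕜 := 𝕜) ψ).domain)
    (hu : ‖analysisOp (𝕜 := 𝕜) ψ u‖ ^ 2 = 1) (h1 : ⟪ψ j, (u : H)⟫_𝕜 = 1) :
    ¬ IsCompleteSeq 𝕜 (fun k : {k : I // k ≠ j} => ψ k) := by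
  intro hcomp
  have hu0 : (u : H) ≠ 0 := by
    intro h
    rw [h, inner_zero_right] at h1
    exact zero_ne_one h1
  have hs := norm_sq_analysisOp_eq_add ψ j ⟨u, (mem_analysisOp_domain_ne_iff ψ j u).2 u.2⟩
  have hz := hasSum_norm_sq_analysisOp (𝕜 := 𝕜) (fun k : {k : I // k ≠ j} => ψ k)
    ⟨u, (mem_analysisOp_domain_ne_iff ψ j u).2 u.2⟩
  -- The splitting of the norm reads `1 = 1 + ‖C' u‖ ^ 2`: the `j`-th term already exhausts the
  -- whole sum.
  simp only [Subtype.coe_eta, hu, h1, norm_one, one_pow, left_eq_add] at hs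
  rw [hs, hasSum_zero_iff_of_nonneg fun _ => by positivity] at hz
  have hpos := hcomp u hu0
  refine hpos.ne' (ENNReal.tsum_eq_zero.2 fun k => ?_)
  rw [congrFun hz k, Pi.zero_apply, ENNReal.ofReal_zero]

/-! ### The canonical dual as a representing vector. -/

variable [CompleteSpace H]

theorem inner_restrictedAnalysisOp (ψ : I → H) (f g : (restrictedAnalysisOp (𝕜 := 𝕜) ψ).domain) :
    ⟪restrictedAnalysisOp (𝕜 := 𝕜) ψ f, restrictedAnalysisOp (𝕜 := 𝕜) ψ g⟫_𝕜 =
      ⟪analysisOp (𝕜 := 𝕜) ψ ⟨(f : domSpace 𝕜 ψ), (mem_restrictedAnalysisOp_domain ψ _).1 f.2⟩,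
        analysisOp (𝕜 := 𝕜) ψ
          ⟨(g : domSpace 𝕜 ψ), (mem_restrictedAnalysisOp_domain ψ _).1 g.2⟩⟫_𝕜 := by
  congr 1
  · ext i
    exact inner_projSeq ψ i f.1
  · ext i
    exact inner_projSeq ψ i g.1

/-- The canonical dual vector lies in the domain of `Γ`, and `Γ` maps it to `π (ψ j)`. -/
theorem exists_genFrameOp_eq_projSeq {ψ : I → H} (h : IsLowerFrameSeq 𝕜 ψ) (j : I) :
    ∃ f : (genFrameOp (𝕜 := 𝕜) ψ).domain, ((f : domSpace 𝕜 ψ) : H) = canonicalDual h j ∧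
      genFrameOp (𝕜 := 𝕜) ψ f = projSeq 𝕜 ψ j := by
  obtain ⟨f, hf⟩ := LinearMap.range_eq_top.1 (range_genFrameOp h) (projSeq 𝕜 ψ j)
  exact ⟨f, congrArg Subtype.val
    (LinearPMap.inverse_apply_eq (ker_genFrameOp h)
      (y := ⟨projSeq 𝕜 ψ j, mem_inverse_genFrameOp_domain h (projSeq 𝕜 ψ j)⟩) (x := f) hf).symm, hf⟩

theorem canonicalDual_mem_domain {ψ : I → H} (h : IsLowerFrameSeq 𝕜 ψ) (j : I) :
    canonicalDual h j ∈ (analysisOp (𝕜 := 𝕜) ψ).domain := by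
  obtain ⟨f, hf, -⟩ := exists_genFrameOp_eq_projSeq h j
  rw [← hf]
  exact (mem_restrictedAnalysisOp_domain ψ _).1 (genFrameOp_domain_le ψ f.2)

/-- This is `⟪Γ f, g⟫ = ⟪C f, C g⟫` at the `f` with `Γ f = π (ψ j)`. The projections disappear
because `f` and `g` lie in `domSpace 𝕜 ψ`. The main theorem needs nothing else about `Γ`. -/
theorem inner_analysisOp_canonicalDual {ψ : I → H} (h : IsLowerFrameSeq 𝕜 ψ) (j : I)
    (g : (analysisOp (𝕜 := 𝕜) ψ).domain) :
    ⟪analysisOp (𝕜 := 𝕜) ψ ⟨canonicalDual h j, canonicalDual_mem_domain h j⟩,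
      analysisOp (𝕜 := 𝕜) ψ g⟫_𝕜 = ⟪ψ j, (g : H)⟫_𝕜 := by
  obtain ⟨f, hf, hΓ⟩ := exists_genFrameOp_eq_projSeq h j
  have hg : (⟨g, subset_closure g.2⟩ : domSpace 𝕜 ψ) ∈
      (restrictedAnalysisOp (𝕜 := 𝕜) ψ).domain := (mem_restrictedAnalysisOp_domain ψ _).2 g.2
  have h1 := inner_genFrameOp ψ f ⟨_, hg⟩
  rw [hΓ, inner_projSeq, inner_restrictedAnalysisOp] at h1
  simp only [← hf]
  exact h1.symm

end Analysis

end FrameSeq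

open FrameSeq in
theorem mainTheorem6 {𝕜 : Type*} [RCLike 𝕜] {H : Type*} [NormedAddCommGroup H]
    [InnerProductSpace 𝕜 H] [CompleteSpace H] {I : Type*} [Countable I]
    (ψ : I → H) (hψ : FrameSeq.IsLowerFrameSeq 𝕜 ψ) (j : I) :
    (⟪FrameSeq.canonicalDual hψ j, ψ j⟫_𝕜 ≠ 1 →
      FrameSeq.IsLowerFrameSeq 𝕜 (fun k : {k : I // k ≠ j} => ψ k)) ∧
    (⟪FrameSeq.canonicalDual hψ j, ψ j⟫_𝕜 = 1 →
      ¬ FrameSeq.IsCompleteSeq 𝕜 (fun k : {k : I // k ≠ j} => ψ k)) := by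
  have hrep := inner_analysisOp_canonicalDual hψ j
  set u : (analysisOp (𝕜 := 𝕜) ψ).domain := ⟨canonicalDual hψ j, canonicalDual_mem_domain hψ j⟩
  have hself : ⟪ψ j, (u : H)⟫_𝕜 = ((‖analysisOp (𝕜 := 𝕜) ψ u‖ ^ 2 : ℝ) : 𝕜) := by
    rw [← hrep u, inner_self_eq_norm_sq_to_K, RCLike.ofReal_pow]
  -- The value is real, so the order of the arguments is immaterial.
  have hflip : ⟪canonicalDual hψ j, ψ j⟫_𝕜 = ((‖analysisOp (𝕜 := 𝕜) ψ u‖ ^ 2 : ℝ) : 𝕜) := by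
    rw [← inner_conj_symm]
    exact (congrArg _ hself).trans (RCLike.conj_ofReal _)
  rw [hflip]
  constructor
  · intro hne
    refine isLowerFrameSeq_ne_of_norm_lt_one hψ j u hrep ?_
    -- One summand is at most the whole sum. With `hself` this becomes `t ^ 2 ≤ t` for `t = ‖C u‖ ^
    -- 2`, which excludes `‖C u‖ > 1`.
    have hle : ‖⟪ψ j, (u : H)⟫_𝕜‖ ^ 2 ≤ ‖analysisOp (𝕜 := 𝕜) ψ u‖ ^ 2 :=
      le_hasSum (hasSum_norm_sq_analysisOp ψ u) j fun _ _ => by positivity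
    rw [hself, RCLike.norm_ofReal, sq_abs] at hle
    have hne1 : ‖analysisOp (𝕜 := 𝕜) ψ u‖ ≠ 1 := fun h => hne (by simp [h])
    refine lt_of_le_of_ne (le_of_not_gt fun h => ?_) hne1
    nlinarith [one_lt_pow₀ h (two_ne_zero)]
  · intro h1
    have hu : ‖analysisOp (𝕜 := 𝕜) ψ u‖ ^ 2 = 1 := by exact_mod_cast h1
    exact not_isCompleteSeq_ne_of_inner_eq_one j u hu (hself.trans h1)
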